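/- Let $(\Omega,\mathcal F,P)$ be a complete probability space and write $L^\infty(P)=L^\infty(\Omega,\mathcal F,P)$. A mapping $\rho:L^\infty(P)\to\mathbb R$ is a *monetary risk measure* if $\rho(X)\ge\rho(Y)$ whenever $X\le Y$ $P$-a.s., and $\rho(X+m)=\rho(X)-m$ for all $X\in L^\infty(P)$ and $m\in\mathbb R$. A monetary risk measure $\rho$ is *positively homogeneous* if $\rho(\alpha X)=\alpha\rho(X)$ for all $X\in L^\infty(P)$ and $\alpha\ge 0$; it is *convex* if $\rho(\alpha X+(1-\alpha)Y)\le\alpha\rho(X)+(1-\alpha)\rho(Y)$ for all $X,Y\in L^\infty(P)$ and $\alpha\in[0,1]$; it is *coherent* if it is convex and positively homogeneous. Let $\mathscr M_{1,f}(P)$ be the set of all finitely additive probability measures $Q$ on $(\Omega,\mathcal F)$ which are absolutely continuous with respect to $P$ (that is, $Q(A)=0$ whenever $A\in\mathcal F$ and $P(A)=0$), with the weak* topology, i.e. the coarsest topology making $Q\mapsto E_Q[X]$ continuous for every $X\in L^\infty(P)$. For a mapping $\rho:L^\infty(P)\to\mathbb R$, the following assertions are equivalent. (a) $\rho$ is a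 positively homogeneous (monetary) risk measure. (b) There exists a family $\{\mathscr Q_\lambda\mid\lambda\in\Lambda\}$ of nonempty, weak*-compact, convex subsets of $\mathscr M_{1,f}(P)$ such that $$\rho(X)=\min_{\lambda\in\Lambda}\max_{Q\in\mathscr Q_\lambda}E_Q[-X]\quad\text{for all }X\in L^\infty(P),$$ where all the maxima and the minimum are attained. (c) There exists a family $\{\rho_\lambda\mid\lambda\in\Lambda\}$ of coherent risk measures on $L^\infty(P)$ such that $$\rho(X)=\min_{\lambda\in\Lambda}\rho_\lambda(X)\quad\text{for all }X\in L^\infty(P),$$ where the minimum is attained. (d) For each $X\in L^\infty(P)$, $$\rho(X)=\inf\{h(X)\mid h\text{ is a coherent risk measure on }L^\infty(P)\text{ and }h\ge\rho\},$$ where $\inf\emptyset=+\infty$. -/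

import Mathlib

open MeasureTheory
open scoped ENNReal

universe u

noncomputable section

namespace RiskMeasure

variable {Ω : Type u} [MeasurableSpace Ω]

/-- `L^∞(P)`: essentially bounded real random variables, modulo `P`-a.s. equality. -/
abbrev Linf (P : Measure Ω) : Type u := Lp ℝ ∞ P

/-- Monetary risk measures: monotone (decreasing) and translation-invariant maps
`ρ : L^∞(P) → ℝ`. Here `Lp.const ∞ P m` is the class of the constant `m`. -/
structure IsMonetary {P : Measure Ω} [IsProbabilityMeasure P] (ρ : Linf P → ℝ) : Prop where
  antitone : ∀ X Y : Linf P, X ≤ᵐ[P] Y → ρ Y ≤ ρ X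
  translation : ∀ (X : Linf P) (m : ℝ), ρ (X + Lp.const ∞ P m) = ρ X - m

/-- Positively homogeneous (monetary) risk measures. -/
structure IsPosHomogeneous {P : Measure Ω} [IsProbabilityMeasure P] (ρ : Linf P → ℝ) : Prop
    extends IsMonetary ρ where
  pos_homogeneous : ∀ (X : Linf P) (α : ℝ), 0 ≤ α → ρ (α • X) = α * ρ X

/-- Convex (monetary) risk measures. -/
structure IsConvex {P : Measure Ω} [IsProbabilityMeasure P] (ρ : Linf P → ℝ) : Prop
    extends IsMonetary ρ where
  convex : ∀ (X Y : Linf P) (α : ℝ), 0 ≤ α → α ≤ 1 →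
    ρ (α • X + (1 - α) • Y) ≤ α * ρ X + (1 - α) * ρ Y

/-- Coherent risk measures: convex and positively homogeneous. -/
structure IsCoherent {P : Measure Ω} [IsProbabilityMeasure P] (ρ : Linf P → ℝ) : Prop
    extends IsConvex ρ, IsPosHomogeneous ρ

/-- `M_{1,f}(P)`: finitely additive probability measures on the σ-algebra of `Ω` which are
absolutely continuous with respect to `P`, as set functions on the measurable sets. -/
@[ext]
structure FinAddProb (P : Measure Ω) where
  toFun : {A : Set Ω // MeasurableSet A} → ℝ
  nonneg : ∀ A, 0 ≤ toFun A
  prob_univ : toFun ⟨Set.univ, MeasurableSet.univ⟩ = 1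
  additive : ∀ (A B : Set Ω) (hA : MeasurableSet A) (hB : MeasurableSet B), Disjoint A B →
    toFun ⟨A ∪ B, hA.union hB⟩ = toFun ⟨A, hA⟩ + toFun ⟨B, hB⟩
  absCont : ∀ (A : Set Ω) (hA : MeasurableSet A), P A = 0 → toFun ⟨A, hA⟩ = 0

namespace FinAddProb

variable {P : Measure Ω}

/-- The integral `∑_c c · Q(s = c)` of a simple function `s`. -/
def simpleIntegral (Q : FinAddProb P) (s : SimpleFunc Ω ℝ) : ℝ :=
  ∑ c ∈ s.range, c * Q.toFun ⟨s ⁻¹' {c}, s.measurableSet_fiber c⟩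

/-- The expectation `E_Q[X]` of `X ∈ L^∞(P)` under a finitely additive probability `Q`: the
supremum of the integrals of the simple functions below `X`. As `X` is `P`-essentially bounded and
`Q` vanishes on `P`-null sets, the set is non-empty and bounded above, and the value is the
usual integral (the limit of the integrals of simple functions tending to `X` in `L^∞`). -/
def expect (Q : FinAddProb P) (X : Linf P) : ℝ :=
  sSup {r : ℝ | ∃ s : SimpleFunc Ω ℝ, (s : Ω → ℝ) ≤ᵐ[P] X ∧ r = Q.simpleIntegral s}

/-- The weak* topology: the coarsest topology for which `Q ↦ E_Q[X]` is continuous for every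
`X ∈ L^∞(P)`. -/
instance weakStarTopology : TopologicalSpace (FinAddProb P) :=
  TopologicalSpace.induced (fun (Q : FinAddProb P) (X : Linf P) => Q.expect X) inferInstance

/-- Convexity of a set of finitely additive probabilities, with respect to the setwise convex
combinations `(a Q₁ + b Q₂)(A) = a Q₁(A) + b Q₂(A)`. -/
def ConvexSet (S : Set (FinAddProb P)) : Prop :=
  Convex ℝ (FinAddProb.toFun '' S)

end FinAddProb

end RiskMeasure

end

noncomputable section

namespace RiskMeasure

variable {Ω : Type u} [MeasurableSpace Ω]

/-! ### Order and norm bounds in `L^∞`. -/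

section Order

variable {P : Measure Ω}

/-! Let `ρ` be positively homogeneous. Each position `Z = X + ρ(X)` has risk zero, and homogeneity
with monotonicity keeps everything above the ray of multiples `α Z`, `α ≥ 0`, acceptable for `ρ`.
This smaller acceptance set is a convex cone, so its capital requirement `conicRisk Z` is coherent
and dominates `ρ`; at `X` the two agree, since capital `ρ(X)` lifts `X` exactly to `Z`. Letting `X`
vary exhibits `ρ` as an attained minimum of coherent measures. Conversely, a finite pointwise
infimum of coherent measures keeps every axiom except convexity (`IsPosHomogeneous.of_isGLB`).

The scenario form rests on duality: finitely additive probabilities are the positive normalized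
functionals on `L^∞` (`expect_ofFunctional`). Hahn–Banach makes a coherent measure an attained
maximum over the scenarios it dominates, and Tychonoff makes that set compact. -/

theorem Linf.smul_le_smul {X Y : Linf P} (h : X ≤ Y) {c : ℝ} (hc : 0 ≤ c) : c • X ≤ c • Y := by
  rw [← Lp.coeFn_le] at h ⊢
  filter_upwards [h, Lp.coeFn_smul c X, Lp.coeFn_smul c Y] with x h h1 h2
  rw [h1, h2]
  exact mul_le_mul_of_nonneg_left h hc

theorem Linf.ae_abs_le_norm (X : Linf P) : ∀ᵐ x ∂P, |X x| ≤ ‖X‖ := by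
  have h := ae_le_eLpNormEssSup (f := (X : Ω → ℝ)) (μ := P)
  filter_upwards [h] with x hx
  rw [← eLpNorm_exponent_top] at hx
  have := (ENNReal.toReal_le_toReal (by simp) (Lp.eLpNorm_ne_top X)).2 hx
  simpa [Lp.norm_def] using this

variable [IsProbabilityMeasure P]

theorem Linf.smul_const (c a : ℝ) : c • Lp.const ∞ P a = Lp.const ∞ P (c * a) :=
  ((Lp.constₗ ∞ P ℝ).map_smul c a).symm

theorem Linf.le_const_norm (X : Linf P) : X ≤ Lp.const ∞ P ‖X‖ := by
  rw [← Lp.coeFn_le]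
  filter_upwards [X.ae_abs_le_norm, Lp.coeFn_const (μ := P) (p := ∞) (c := ‖X‖)] with x h h1
  rw [h1]
  exact (le_abs_self _).trans h

end Order

/-! ### Positively homogeneous measures as infima of coherent ones. -/

section Coherent

variable {P : Measure Ω} [IsProbabilityMeasure P] {ρ : Linf P → ℝ}

theorem IsMonetary.mono (h : IsMonetary ρ) {X Y : Linf P} (hXY : X ≤ Y) : ρ Y ≤ ρ X :=
  h.antitone X Y ((Lp.coeFn_le X Y).2 hXY)

theorem IsPosHomogeneous.map_zero (h : IsPosHomogeneous ρ) : ρ 0 = 0 := by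
  simpa using h.pos_homogeneous 0 0 le_rfl

theorem IsCoherent.of_subadditive (h : IsPosHomogeneous ρ) (hadd : ∀ X Y, ρ (X + Y) ≤ ρ X + ρ Y) :
    IsCoherent ρ where
  antitone := h.antitone
  translation := h.translation
  pos_homogeneous := h.pos_homogeneous
  convex X Y α h0 h1 := by
    rw [← h.pos_homogeneous X α h0, ← h.pos_homogeneous Y (1 - α) (by linarith)]
    exact hadd _ _

theorem IsCoherent.subadditive (h : IsCoherent ρ) (X Y : Linf P) : ρ (X + Y) ≤ ρ X + ρ Y := by
  have h1 := h.convex ((2 : ℝ) • X) ((2 : ℝ) • Y) (1 / 2) (by norm_num) (by norm_num)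
  rw [h.pos_homogeneous X 2 (by norm_num), h.pos_homogeneous Y 2 (by norm_num), smul_smul,
    smul_smul] at h1
  norm_num at h1
  linarith

/-- The amounts of cash that lift `Y` above a nonnegative multiple of `Z`. -/
def conicCapital (Z Y : Linf P) : Set ℝ :=
  {m | ∃ α : ℝ, 0 ≤ α ∧ α • Z ≤ Y + Lp.const ∞ P m}

/-- The risk measure whose acceptance set is the monotone cone generated by `Z`. -/
def conicRisk (Z Y : Linf P) : ℝ := sInf (conicCapital Z Y)

theorem conicCapital_nonempty (Z Y : Linf P) : (conicCapital Z Y).Nonempty := by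
  refine ⟨‖-Y‖, 0, le_rfl, ?_⟩
  have := Linf.le_const_norm (-Y)
  rw [zero_smul]
  calc (0 : Linf P) = Y + -Y := by simp
    _ ≤ _ := by gcongr

theorem IsPosHomogeneous.le_of_mem_conicCapital (h : IsPosHomogeneous ρ) {Z Y : Linf P}
    (hZ : ρ Z ≤ 0) {m : ℝ} (hm : m ∈ conicCapital Z Y) : ρ Y ≤ m := by
  obtain ⟨α, hα, hle⟩ := hm
  have h1 := h.mono hle
  rw [h.translation, h.pos_homogeneous Z α hα] at h1
  nlinarith

theorem IsPosHomogeneous.le_conicRisk (h : IsPosHomogeneous ρ) {Z : Linf P} (hZ : ρ Z ≤ 0)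
    (Y : Linf P) : ρ Y ≤ conicRisk Z Y :=
  le_csInf (conicCapital_nonempty Z Y) fun _ hm => h.le_of_mem_conicCapital hZ hm

theorem conicCapital_smul_subset {Z Y : Linf P} {m c : ℝ} (hc : 0 ≤ c)
    (hm : m ∈ conicCapital Z Y) : c * m ∈ conicCapital Z (c • Y) := by
  obtain ⟨α, hα, hle⟩ := hm
  refine ⟨c * α, mul_nonneg hc hα, ?_⟩
  rw [mul_smul, ← Linf.smul_const, ← smul_add]
  exact Linf.smul_le_smul hle hc

/-- Domination by `ρ` keeps the infimum finite. Subadditivity comes from the cone: capitals using `α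
Z` and `β Z` add up to one using `(α + β) Z`. -/
theorem IsPosHomogeneous.isCoherent_conicRisk (h : IsPosHomogeneous ρ) {Z : Linf P}
    (hZ : ρ Z ≤ 0) : IsCoherent (conicRisk Z) := by
  have hb : ∀ Y, BddBelow (conicCapital Z Y) := fun Y =>
    ⟨ρ Y, fun _ hm => h.le_of_mem_conicCapital hZ hm⟩
  have htrans : ∀ (X : Linf P) (m : ℝ),
      conicRisk Z (X + Lp.const ∞ P m) ≤ conicRisk Z X - m := by
    intro X m
    rw [le_sub_iff_add_le]
    refine le_csInf (conicCapital_nonempty Z X) fun k ⟨α, hα, hle⟩ => ?_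
    rw [← le_sub_iff_add_le]
    refine csInf_le (hb _) ⟨α, hα, ?_⟩
    rwa [add_assoc, ← map_add, add_sub_cancel]
  have hsmul : ∀ (X : Linf P) (c : ℝ), 0 < c → conicRisk Z (c • X) ≤ c * conicRisk Z X := by
    intro X c hc
    rw [← div_le_iff₀' hc]
    refine le_csInf (conicCapital_nonempty Z X) fun m hm => ?_
    rw [div_le_iff₀' hc]
    exact csInf_le (hb _) (conicCapital_smul_subset hc.le hm)
  have hzero : conicRisk Z 0 = 0 := by
    refine le_antisymm (csInf_le (hb _) ⟨0, le_rfl, by simp⟩) ?_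
    exact h.map_zero.symm.le.trans (h.le_conicRisk hZ 0)
  refine IsCoherent.of_subadditive ⟨⟨fun X Y hXY => ?_, fun X m => le_antisymm (htrans X m) ?_⟩,
    fun X c hc => ?_⟩ fun X Y => ?_
  · refine csInf_le_csInf (hb _) (conicCapital_nonempty Z X) fun m ⟨α, hα, hle⟩ => ⟨α, hα, ?_⟩
    exact hle.trans (by gcongr; exact (Lp.coeFn_le X Y).1 hXY)
  · have := htrans (X + Lp.const ∞ P m) (-m)
    rw [add_assoc, ← map_add, add_neg_cancel, _root_.map_zero, add_zero] at this
    linarith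
  · rcases hc.eq_or_lt with rfl | hc
    · simp [hzero]
    refine le_antisymm (hsmul X c hc) ?_
    have := hsmul (c • X) c⁻¹ (by positivity)
    rw [smul_smul, inv_mul_cancel₀ hc.ne', one_smul] at this
    rwa [inv_mul_eq_div, le_div_iff₀' hc] at this
  · rw [← sub_le_iff_le_add]
    refine le_csInf (conicCapital_nonempty Z X) fun a ⟨α, hα, ha'⟩ => ?_
    rw [sub_le_comm]
    refine le_csInf (conicCapital_nonempty Z Y) fun b ⟨β, hβ, hb'⟩ => ?_
    rw [sub_le_iff_le_add]
    refine csInf_le (hb _) ⟨α + β, add_nonneg hα hβ, ?_⟩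
    rw [add_smul, add_comm b a, map_add, add_add_add_comm]
    exact add_le_add ha' hb'

theorem IsPosHomogeneous.conicRisk_add_const_self (h : IsPosHomogeneous ρ) {X : Linf P} {c : ℝ}
    (hX : ρ X = c) : conicRisk (X + Lp.const ∞ P c) X = c := by
  have hZ : ρ (X + Lp.const ∞ P c) ≤ 0 := by rw [h.translation, hX, sub_self]
  refine le_antisymm ?_ (hX ▸ h.le_conicRisk hZ X)
  exact csInf_le ⟨ρ X, fun _ hm => h.le_of_mem_conicCapital hZ hm⟩ ⟨1, zero_le_one, by simp⟩

/-- A pointwise infimum of coherent risk measures is a positively homogeneous risk measure. -/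
theorem IsPosHomogeneous.of_isGLB {S : Set (Linf P → ℝ)} (hS : ∀ h ∈ S, IsCoherent h)
    (hne : S.Nonempty) (hρ : ∀ X, IsGLB ((fun h => h X) '' S) (ρ X)) : IsPosHomogeneous ρ := by
  have hle : ∀ h ∈ S, ∀ X, ρ X ≤ h X := fun h hh X => (hρ X).1 ⟨h, hh, rfl⟩
  have hge : ∀ X c, (∀ h ∈ S, c ≤ h X) → c ≤ ρ X := by
    rintro X c hc
    refine (hρ X).2 ?_
    rintro _ ⟨h, hh, rfl⟩
    exact hc h hh
  refine ⟨⟨fun X Y hXY => hge X _ fun h hh => (hle h hh Y).trans ((hS h hh).antitone X Y hXY),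
    fun X m => le_antisymm ?_ ?_⟩, fun X α hα => ?_⟩
  · rw [le_sub_iff_add_le]
    refine hge X _ fun h hh => ?_
    have := hle h hh (X + Lp.const ∞ P m)
    rw [(hS h hh).translation] at this
    linarith
  · refine hge _ _ fun h hh => ?_
    rw [(hS h hh).translation]
    linarith [hle h hh X]
  · rcases hα.eq_or_lt with rfl | hα
    -- At `α = 0` scaling cannot be inverted; the value is read off from `h 0 = 0`.
    · obtain ⟨h, hh⟩ := hne
      have h0 : ∀ h ∈ S, h 0 = 0 := fun h hh => by
        simpa using (hS h hh).pos_homogeneous 0 0 le_rfl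
      rw [zero_smul, zero_mul]
      exact le_antisymm ((hle h hh 0).trans (h0 h hh).le) (hge 0 0 fun h hh => (h0 h hh).ge)
    refine le_antisymm ?_ (hge _ _ fun h hh => ?_)
    · rw [← div_le_iff₀' hα]
      refine hge X _ fun h hh => ?_
      rw [div_le_iff₀' hα, ← (hS h hh).pos_homogeneous X α hα.le]
      exact hle h hh _
    · rw [(hS h hh).pos_homogeneous X α hα.le]
      exact mul_le_mul_of_nonneg_left (hle h hh X) hα.le

end Coherent

/-! ### Uniform approximation by simple functions. -/

section SimpleClass

variable (P : Measure Ω)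

/-- The class in `L^∞` of a simple function. -/
def simpleClass (s : SimpleFunc Ω ℝ) : Linf P := (s.memLp_top P).toLp s

variable {P}

theorem coeFn_simpleClass (s : SimpleFunc Ω ℝ) : simpleClass P s =ᵐ[P] s := MemLp.coeFn_toLp _

theorem simpleClass_le_iff {s : SimpleFunc Ω ℝ} {X : Linf P} : simpleClass P s ≤ X ↔ s ≤ᵐ[P] X := by
  rw [← Lp.coeFn_le]
  exact Filter.eventuallyLE_congr (coeFn_simpleClass s) Filter.EventuallyEq.rfl

theorem simpleClass_le_simpleClass {s t : SimpleFunc Ω ℝ} :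
    simpleClass P s ≤ simpleClass P t ↔ s ≤ᵐ[P] t := by
  rw [← Lp.coeFn_le]
  exact Filter.eventuallyLE_congr (coeFn_simpleClass s) (coeFn_simpleClass t)

theorem simpleClass_add (s t : SimpleFunc Ω ℝ) :
    simpleClass P (s + t) = simpleClass P s + simpleClass P t := rfl

theorem simpleClass_smul (c : ℝ) (s : SimpleFunc Ω ℝ) :
    simpleClass P (c • s) = c • simpleClass P s := rfl

theorem simpleClass_const [IsProbabilityMeasure P] (c : ℝ) :
    simpleClass P (SimpleFunc.const Ω c) = Lp.const ∞ P c := rfl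

/-- Bounded measurable functions are approximated from below by simple functions. -/
theorem exists_simpleFunc_le_of_bounded {g : Ω → ℝ} (hg : Measurable g) {C : ℝ}
    (hC : ∀ x, |g x| ≤ C) {ε : ℝ} (hε : 0 < ε) :
    ∃ s : SimpleFunc Ω ℝ, ∀ x, s x ≤ g x ∧ g x ≤ s x + ε := by
  -- Rounding `g` down to the grid `εℤ` takes finitely many values because `g` is bounded.
  let k : Ω → ℤ := fun x => ⌊g x / ε⌋
  have hk : Measurable k := (hg.div_const ε).floor
  have hfin : (Set.range k).Finite := by
    refine (Set.finite_Icc ⌊-C / ε⌋ ⌊C / ε⌋).subset ?_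
    rintro _ ⟨x, rfl⟩
    have := abs_le.1 (hC x)
    exact ⟨Int.floor_mono (by gcongr; exact this.1), Int.floor_mono (by gcongr; exact this.2)⟩
  let K : SimpleFunc Ω ℤ := ⟨k, fun n => hk (measurableSet_singleton n), hfin⟩
  refine ⟨K.map fun n : ℤ => (n : ℝ) * ε, fun x => ?_⟩
  change (⌊g x / ε⌋ : ℝ) * ε ≤ g x ∧ g x ≤ (⌊g x / ε⌋ : ℝ) * ε + ε
  constructor
  · rw [← le_div_iff₀ hε]
    exact Int.floor_le _
  · rw [← add_one_mul, ← div_le_iff₀ hε]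
    exact (Int.lt_floor_add_one _).le

theorem exists_simpleClass_le [IsProbabilityMeasure P] (X : Linf P) {ε : ℝ} (hε : 0 < ε) :
    ∃ s : SimpleFunc Ω ℝ,
      simpleClass P s ≤ X ∧ X ≤ simpleClass P (s + SimpleFunc.const Ω ε) := by
  -- Truncation gives an everywhere bounded representative of `X`.
  let g : Ω → ℝ := fun x => max (-‖X‖) (min (X x) ‖X‖)
  have hg : Measurable g :=
    measurable_const.max ((Lp.stronglyMeasurable X).measurable.min measurable_const)
  have hb : ∀ x, |g x| ≤ ‖X‖ := fun x =>
    abs_le.2 ⟨le_max_left _ _, max_le (by linarith [norm_nonneg X]) (min_le_right _ _)⟩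
  have hgX : ∀ᵐ x ∂P, g x = X x := by
    filter_upwards [X.ae_abs_le_norm] with x hx
    rw [abs_le] at hx
    simp only [g]
    rw [min_eq_left hx.2, max_eq_right hx.1]
  obtain ⟨s, hs⟩ := exists_simpleFunc_le_of_bounded hg hb hε
  refine ⟨s, simpleClass_le_iff.2 ?_, (Lp.coeFn_le _ _).1 ?_⟩
  · filter_upwards [hgX] with x hx
    rw [← hx]
    exact (hs x).1
  · filter_upwards [hgX, coeFn_simpleClass (P := P) (s + SimpleFunc.const Ω ε)] with x hx h1
    rw [h1, ← hx]
    exact (hs x).2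

/-- The indicator of a measurable set, as a simple function. -/
def indicatorSimple (A : Set Ω) (hA : MeasurableSet A) (c : ℝ) : SimpleFunc Ω ℝ :=
  SimpleFunc.piecewise A hA (SimpleFunc.const Ω c) (SimpleFunc.const Ω 0)

theorem indicatorSimple_apply (A : Set Ω) (hA : MeasurableSet A) (c : ℝ) (x : Ω) :
    indicatorSimple A hA c x = A.indicator (fun _ => c) x := by
  classical
  simp [indicatorSimple, SimpleFunc.piecewise_apply, Set.indicator_apply]

theorem indicatorSimple_eq_smul (A : Set Ω) (hA : MeasurableSet A) (c : ℝ) :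
    indicatorSimple A hA c = c • indicatorSimple A hA 1 := by
  classical
  ext x
  simp [indicatorSimple_apply, Set.indicator_apply]

end SimpleClass

/-! ### Integration against finitely additive probabilities. -/

namespace FinAddProb

variable {P : Measure Ω}

/-- The set function of `Q` valued in scalar operators, extended by zero to nonmeasurable sets. -/
def operatorMeasure (Q : FinAddProb P) (A : Set Ω) : ℝ →L[ℝ] ℝ := by
  classical
  exact if hA : MeasurableSet A then Q.toFun ⟨A, hA⟩ • ContinuousLinearMap.id ℝ ℝ else 0

theorem operatorMeasure_apply (Q : FinAddProb P) {A : Set Ω} (hA : MeasurableSet A) (c : ℝ) :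
    Q.operatorMeasure A c = c * Q.toFun ⟨A, hA⟩ := by
  simp [operatorMeasure, hA, mul_comm]

theorem finMeasAdditive_operatorMeasure (Q : FinAddProb P) :
    FinMeasAdditive P Q.operatorMeasure := by
  intro A B hA hB _ _ hAB
  ext
  rw [add_apply, Q.operatorMeasure_apply hA, Q.operatorMeasure_apply hB,
    Q.operatorMeasure_apply (hA.union hB), Q.additive A B hA hB hAB, mul_add]

theorem simpleIntegral_eq_setToSimpleFunc (Q : FinAddProb P) (s : SimpleFunc Ω ℝ) :
    Q.simpleIntegral s = s.setToSimpleFunc Q.operatorMeasure :=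
  Finset.sum_congr rfl fun c _ => (Q.operatorMeasure_apply (s.measurableSet_fiber c) c).symm

theorem simpleIntegral_indicatorSimple (Q : FinAddProb P) {A : Set Ω} (hA : MeasurableSet A)
    (c : ℝ) : Q.simpleIntegral (indicatorSimple A hA c) = c * Q.toFun ⟨A, hA⟩ := by
  rw [simpleIntegral_eq_setToSimpleFunc, indicatorSimple, SimpleFunc.setToSimpleFunc_indicator _
    Q.finMeasAdditive_operatorMeasure.map_empty_eq_zero, Q.operatorMeasure_apply hA]

theorem simpleIntegral_const (Q : FinAddProb P) (c : ℝ) :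
    Q.simpleIntegral (SimpleFunc.const Ω c) = c := by
  rw [simpleIntegral_eq_setToSimpleFunc, SimpleFunc.setToSimpleFunc_const _
    Q.finMeasAdditive_operatorMeasure.map_empty_eq_zero, Q.operatorMeasure_apply .univ,
    Q.prob_univ, mul_one]

variable [IsProbabilityMeasure P]

theorem simpleIntegral_add (Q : FinAddProb P) (s t : SimpleFunc Ω ℝ) :
    Q.simpleIntegral (s + t) = Q.simpleIntegral s + Q.simpleIntegral t := by
  simp only [simpleIntegral_eq_setToSimpleFunc]
  exact SimpleFunc.setToSimpleFunc_add _ Q.finMeasAdditive_operatorMeasure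
    (SimpleFunc.integrable_of_isFiniteMeasure s) (SimpleFunc.integrable_of_isFiniteMeasure t)

theorem simpleIntegral_smul (Q : FinAddProb P) (c : ℝ) (s : SimpleFunc Ω ℝ) :
    Q.simpleIntegral (c • s) = c * Q.simpleIntegral s := by
  simp only [simpleIntegral_eq_setToSimpleFunc]
  exact SimpleFunc.setToSimpleFunc_smul_real _ Q.finMeasAdditive_operatorMeasure c
    (SimpleFunc.integrable_of_isFiniteMeasure s)

theorem simpleIntegral_mono (Q : FinAddProb P) {s t : SimpleFunc Ω ℝ} (h : s ≤ᵐ[P] t) :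
    Q.simpleIntegral s ≤ Q.simpleIntegral t := by
  have hadd := Q.finMeasAdditive_operatorMeasure
  have hint : ∀ u : SimpleFunc Ω ℝ, Integrable u P := SimpleFunc.integrable_of_isFiniteMeasure
  simp only [simpleIntegral_eq_setToSimpleFunc]
  -- Replacing `s` by `s ⊓ t` changes it only on a null set, invisible to `Q`, and makes the
  -- inequality hold everywhere.
  have hst : s =ᵐ[P] (s ⊓ t : SimpleFunc Ω ℝ) := by
    filter_upwards [h] with x hx
    exact (min_eq_left hx).symm
  rw [SimpleFunc.setToSimpleFunc_congr _ (fun A hA h0 => ?_) hadd (hint s) hst]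
  · refine SimpleFunc.setToSimpleFunc_mono hadd (fun A hA _ c hc => ?_) (hint _) (hint _)
      inf_le_right
    rw [Q.operatorMeasure_apply hA]
    exact mul_nonneg hc (Q.nonneg _)
  · ext
    rw [Q.operatorMeasure_apply hA, Q.absCont A hA h0, mul_zero, zero_apply]

theorem simpleIntegral_le_expect (Q : FinAddProb P) {s : SimpleFunc Ω ℝ} {X : Linf P}
    (h : simpleClass P s ≤ X) : Q.simpleIntegral s ≤ Q.expect X := by
  obtain ⟨t, -, ht⟩ := exists_simpleClass_le X one_pos
  refine le_csSup ⟨Q.simpleIntegral (t + SimpleFunc.const Ω 1), ?_⟩ ⟨s, simpleClass_le_iff.1 h, rfl⟩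
  rintro _ ⟨s, hs, rfl⟩
  exact Q.simpleIntegral_mono (simpleClass_le_simpleClass.1 ((simpleClass_le_iff.2 hs).trans ht))

theorem expect_le_simpleIntegral (Q : FinAddProb P) {s : SimpleFunc Ω ℝ} {X : Linf P}
    (h : X ≤ simpleClass P s) : Q.expect X ≤ Q.simpleIntegral s := by
  obtain ⟨t, ht, -⟩ := exists_simpleClass_le X one_pos
  refine csSup_le ⟨_, t, simpleClass_le_iff.1 ht, rfl⟩ ?_
  rintro _ ⟨s, hs, rfl⟩
  exact Q.simpleIntegral_mono (simpleClass_le_simpleClass.1 ((simpleClass_le_iff.2 hs).trans h))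

theorem expect_simpleClass (Q : FinAddProb P) (s : SimpleFunc Ω ℝ) :
    Q.expect (simpleClass P s) = Q.simpleIntegral s :=
  le_antisymm (Q.expect_le_simpleIntegral le_rfl) (Q.simpleIntegral_le_expect le_rfl)

theorem exists_expect_approx (Q : FinAddProb P) (X : Linf P) {ε : ℝ} (hε : 0 < ε) :
    ∃ s : SimpleFunc Ω ℝ, simpleClass P s ≤ X ∧ X ≤ simpleClass P (s + SimpleFunc.const Ω ε) ∧
      Q.simpleIntegral s ≤ Q.expect X ∧ Q.expect X ≤ Q.simpleIntegral s + ε := by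
  obtain ⟨s, h1, h2⟩ := exists_simpleClass_le X hε
  refine ⟨s, h1, h2, Q.simpleIntegral_le_expect h1, ?_⟩
  simpa [simpleIntegral_add, simpleIntegral_const] using Q.expect_le_simpleIntegral h2

theorem expect_mono (Q : FinAddProb P) {X Y : Linf P} (h : X ≤ Y) : Q.expect X ≤ Q.expect Y := by
  refine le_of_forall_pos_le_add fun ε hε => ?_
  obtain ⟨s, h1, -, -, h4⟩ := Q.exists_expect_approx X hε
  linarith [Q.simpleIntegral_le_expect (h1.trans h)]

theorem expect_add (Q : FinAddProb P) (X Y : Linf P) :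
    Q.expect (X + Y) = Q.expect X + Q.expect Y := by
  have key : ∀ ε : ℝ, 0 < ε → |Q.expect (X + Y) - (Q.expect X + Q.expect Y)| ≤ 2 * ε := by
    intro ε hε
    obtain ⟨s, s1, s2, s3, s4⟩ := Q.exists_expect_approx X hε
    obtain ⟨t, t1, t2, t3, t4⟩ := Q.exists_expect_approx Y hε
    have lo := Q.simpleIntegral_le_expect
      ((simpleClass_add s t).le.trans (add_le_add s1 t1))
    have hi := Q.expect_le_simpleIntegral ((add_le_add s2 t2).trans (simpleClass_add _ _).ge)
    simp only [simpleIntegral_add, simpleIntegral_const] at lo hi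
    rw [abs_le]
    constructor <;> linarith
  refine eq_of_forall_dist_le fun ε hε => ?_
  simpa [Real.dist_eq, mul_div_cancel₀] using key (ε / 2) (by positivity)

theorem expect_smul_of_nonneg (Q : FinAddProb P) {c : ℝ} (hc : 0 ≤ c) (X : Linf P) :
    Q.expect (c • X) = c * Q.expect X := by
  have key : ∀ ε : ℝ, 0 < ε → |Q.expect (c • X) - c * Q.expect X| ≤ c * ε := by
    intro ε hε
    obtain ⟨s, s1, s2, s3, s4⟩ := Q.exists_expect_approx X hε
    have lo := Q.simpleIntegral_le_expect
      ((simpleClass_smul c s).le.trans (Linf.smul_le_smul s1 hc))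
    have hi := Q.expect_le_simpleIntegral
      ((Linf.smul_le_smul s2 hc).trans (simpleClass_smul c _).ge)
    simp only [simpleIntegral_add, simpleIntegral_const, simpleIntegral_smul] at lo hi
    rw [abs_le]
    constructor <;> nlinarith
  refine eq_of_forall_dist_le fun ε hε => ?_
  -- Dividing by `c + 1` rather than `c` covers `c = 0`.
  refine (key (ε / (c + 1)) (by positivity)).trans ?_
  rw [mul_div_assoc', div_le_iff₀ (by positivity)]
  nlinarith

theorem expect_const (Q : FinAddProb P) (c : ℝ) : Q.expect (Lp.const ∞ P c) = c := by
  rw [← simpleClass_const, expect_simpleClass, simpleIntegral_const]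

theorem expect_neg (Q : FinAddProb P) (X : Linf P) : Q.expect (-X) = -Q.expect X := by
  have h := Q.expect_add X (-X)
  rw [add_neg_cancel, ← map_zero (Lp.const ∞ P), expect_const] at h
  linarith

/-- The expectation as a linear functional on `L^∞`. -/
def expectLinear (Q : FinAddProb P) : Linf P →ₗ[ℝ] ℝ where
  toFun := Q.expect
  map_add' := Q.expect_add
  map_smul' c X := by
    rcases le_total 0 c with hc | hc
    · exact Q.expect_smul_of_nonneg hc X
    · have := Q.expect_smul_of_nonneg (neg_nonneg.2 hc) X
      rw [neg_smul, expect_neg] at this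
      simp only [RingHom.id_apply, smul_eq_mul]
      linarith

theorem toFun_eq_expect (Q : FinAddProb P) (A : Set Ω) (hA : MeasurableSet A) :
    Q.toFun ⟨A, hA⟩ = Q.expect (simpleClass P (indicatorSimple A hA 1)) := by
  rw [expect_simpleClass, simpleIntegral_indicatorSimple, one_mul]

/-- The finitely additive probability `A ↦ f(1_A)` of a positive normalized functional `f`. -/
def ofFunctional (f : Linf P →ₗ[ℝ] ℝ) (hpos : ∀ X, 0 ≤ X → 0 ≤ f X)
    (hone : f (Lp.const ∞ P 1) = 1) : FinAddProb P where
  toFun A := f (simpleClass P (indicatorSimple A.1 A.2 1))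
  nonneg A := by
    refine hpos _ ((Lp.coeFn_nonneg _).1 ?_)
    filter_upwards [coeFn_simpleClass (P := P) (indicatorSimple A.1 A.2 1)] with x hx
    rw [hx, indicatorSimple_apply]
    exact Set.indicator_nonneg (fun _ _ => zero_le_one) x
  prob_univ := by
    refine Eq.trans ?_ hone
    rw [← simpleClass_const]
    congr 2
    ext x
    simp [indicatorSimple_apply]
  additive A B hA hB hAB := by
    rw [← map_add, ← simpleClass_add]
    congr 2
    ext x
    simp [indicatorSimple_apply, Set.indicator_union_of_disjoint hAB]
  absCont A hA h0 := by
    rw [← map_zero f]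
    congr 1
    refine Lp.ext ?_
    filter_upwards [coeFn_simpleClass (P := P) (indicatorSimple A hA 1), Lp.coeFn_zero ℝ ∞ P,
      measure_eq_zero_iff_ae_notMem.1 h0] with x h1 h2 h3
    rw [h1, h2, indicatorSimple_apply, Set.indicator_of_notMem h3, Pi.zero_apply]

theorem simpleIntegral_ofFunctional (f : Linf P →ₗ[ℝ] ℝ) (hpos : ∀ X, 0 ≤ X → 0 ≤ f X)
    (hone : f (Lp.const ∞ P 1) = 1) (s : SimpleFunc Ω ℝ) :
    (ofFunctional f hpos hone).simpleIntegral s = f (simpleClass P s) := by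
  induction s using SimpleFunc.induction with
  | const c hA =>
    change (ofFunctional f hpos hone).simpleIntegral (indicatorSimple _ hA c) =
      f (simpleClass P (indicatorSimple _ hA c))
    rw [simpleIntegral_indicatorSimple, indicatorSimple_eq_smul, simpleClass_smul, map_smul]
    rfl
  | add _ hs ht => rw [simpleIntegral_add, hs, ht, simpleClass_add, map_add]

theorem expect_ofFunctional (f : Linf P →ₗ[ℝ] ℝ) (hpos : ∀ X, 0 ≤ X → 0 ≤ f X)
    (hone : f (Lp.const ∞ P 1) = 1) (X : Linf P) :
    (ofFunctional f hpos hone).expect X = f X := by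
  have hmono : ∀ {Y Z : Linf P}, Y ≤ Z → f Y ≤ f Z := fun {Y Z} h => by
    have := hpos (Z - Y) (sub_nonneg.2 h)
    rw [map_sub] at this
    linarith
  refine eq_of_forall_dist_le fun ε hε => ?_
  obtain ⟨s, h1, h2, h3, h4⟩ := (ofFunctional f hpos hone).exists_expect_approx X hε
  have h5 := hmono h1
  have h6 := hmono h2
  rw [← simpleIntegral_ofFunctional f hpos hone] at h5 h6
  rw [simpleIntegral_add, simpleIntegral_const] at h6
  rw [Real.dist_eq, abs_le]
  constructor <;> linarith

end FinAddProb

/-! ### Duality for coherent risk measures. -/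

variable {P : Measure Ω} [IsProbabilityMeasure P]

/-- Hahn–Banach extends `c • X ↦ c * h X` from the line through `X`; for negative `c` domination
follows from `0 = h 0 ≤ h (c • X) + h (-c • X)`. -/
theorem IsCoherent.exists_linear_le {h : Linf P → ℝ} (hh : IsCoherent h) (X : Linf P) :
    ∃ g : Linf P →ₗ[ℝ] ℝ, g X = h X ∧ ∀ Y, g Y ≤ h Y := by
  have h0 : h 0 = 0 := hh.toIsPosHomogeneous.map_zero
  have H : ∀ c : ℝ, c • X = 0 → RingHom.id ℝ c • h X = 0 := by
    intro c hc
    rcases smul_eq_zero.1 hc with rfl | rfl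
    · simp
    · simp [h0]
  obtain ⟨g, hg, hle⟩ := exists_extension_of_le_sublinear
    (LinearPMap.mkSpanSingleton' (σ := RingHom.id ℝ) X (h X) H) h
    (fun c hc Y => hh.pos_homogeneous Y c hc.le) hh.subadditive (by
      rintro ⟨Y, hY⟩
      obtain ⟨c, rfl⟩ := Submodule.mem_span_singleton.1 hY
      rw [LinearPMap.mkSpanSingleton'_apply]
      rcases le_total 0 c with hc | hc
      · exact (hh.pos_homogeneous X c hc).ge
      · have h1 := hh.subadditive (c • X) ((-c) • X)
        rw [← add_smul, add_neg_cancel, zero_smul, h0, hh.pos_homogeneous X (-c) (by linarith)]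
          at h1
        simp only [RingHom.id_apply, smul_eq_mul]
        linarith)
  refine ⟨g, ?_, hle⟩
  have hX := Submodule.mem_span_singleton_self (R := ℝ) X
  exact (hg ⟨X, hX⟩).trans (LinearPMap.mkSpanSingleton'_apply_self X (h X) H hX)

/-- The scenarios whose expected loss never exceeds `h`. -/
def dominatedScenarios (h : Linf P → ℝ) : Set (FinAddProb P) :=
  {Q | ∀ X, Q.expect (-X) ≤ h X}

/-- Domination by `h` forces positivity through monotonicity, and normalization through the
constants `1` and `-1`. -/
theorem IsCoherent.exists_expect_eq {h : Linf P → ℝ} (hh : IsCoherent h) {f : Linf P →ₗ[ℝ] ℝ}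
    (hf : ∀ X, f (-X) ≤ h X) : ∃ Q ∈ dominatedScenarios h, ∀ X, Q.expect X = f X := by
  have h0 : h 0 = 0 := hh.toIsPosHomogeneous.map_zero
  have hconst : ∀ m : ℝ, h (Lp.const ∞ P m) = -m := fun m => by
    simpa [h0] using hh.translation 0 m
  have hpos : ∀ X, 0 ≤ X → 0 ≤ f X := fun X hX => by
    have h1 := hf X
    have h2 := hh.toIsMonetary.mono hX
    rw [map_neg] at h1
    linarith
  have hone : f (Lp.const ∞ P 1) = 1 := by
    have h1 := hf (Lp.const ∞ P 1)
    have h2 := hf (Lp.const ∞ P (-1))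
    rw [hconst] at h1 h2
    simp only [map_neg, neg_neg] at h1 h2
    linarith
  refine ⟨FinAddProb.ofFunctional f hpos hone, fun X => ?_,
    FinAddProb.expect_ofFunctional f hpos hone⟩
  rw [FinAddProb.expect_ofFunctional]
  exact hf X

/-- The representation of a coherent risk measure by its worst-case scenarios. -/
theorem IsCoherent.isGreatest_dominatedScenarios {h : Linf P → ℝ} (hh : IsCoherent h)
    (X : Linf P) :
    IsGreatest ((fun Q : FinAddProb P => Q.expect (-X)) '' dominatedScenarios h) (h X) := by
  constructor
  · obtain ⟨g, hg, hle⟩ := hh.exists_linear_le X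
    obtain ⟨Q, hQ, hQg⟩ := hh.exists_expect_eq (f := -g) fun Y => by
      simpa using hle Y
    exact ⟨Q, hQ, by simp [hQg, hg]⟩
  · rintro _ ⟨Q, hQ, rfl⟩
    exact hQ X

theorem IsCoherent.convexSet_dominatedScenarios {h : Linf P → ℝ} (hh : IsCoherent h) :
    FinAddProb.ConvexSet (dominatedScenarios h) := by
  rintro _ ⟨Q₁, h₁, rfl⟩ _ ⟨Q₂, h₂, rfl⟩ a b ha hb hab
  obtain ⟨Q, hQ, hQe⟩ := hh.exists_expect_eq (f := a • Q₁.expectLinear + b • Q₂.expectLinear)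
    fun X => by
      change a * Q₁.expect (-X) + b * Q₂.expect (-X) ≤ h X
      calc _ ≤ a * h X + b * h X := by gcongr <;> [exact h₁ X; exact h₂ X]
        _ = h X := by rw [← add_mul, hab, one_mul]
  refine ⟨Q, hQ, ?_⟩
  ext ⟨A, hA⟩
  simp only [Pi.add_apply, Pi.smul_apply, FinAddProb.toFun_eq_expect, hQe]
  rfl

/-- Evaluation identifies the scenarios with the linear functionals in a product of compact
intervals; linearity is a closed condition for pointwise convergence. -/
theorem IsCoherent.isCompact_dominatedScenarios {h : Linf P → ℝ} (hh : IsCoherent h) :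
    IsCompact (dominatedScenarios h) := by
  have hind : Topology.IsInducing (fun (Q : FinAddProb P) (X : Linf P) => Q.expect X) := ⟨rfl⟩
  rw [hind.isCompact_iff]
  have himage : (fun (Q : FinAddProb P) (X : Linf P) => Q.expect X) '' dominatedScenarios h =
      Set.pi Set.univ (fun X => Set.Icc (-h X) (h (-X))) ∩
        ({f | ∀ X Y, f (X + Y) = f X + f Y} ∩ {f | ∀ (c : ℝ) X, f (c • X) = c * f X}) := by
    ext f
    constructor
    · rintro ⟨Q, hQ, rfl⟩
      refine ⟨fun X _ => ⟨?_, ?_⟩, Q.expectLinear.map_add, Q.expectLinear.map_smul⟩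
      · have := hQ X
        rw [Q.expect_neg] at this
        linarith
      · simpa using hQ (-X)
    · rintro ⟨h1, h2, h3⟩
      obtain ⟨Q, hQ, hQe⟩ := hh.exists_expect_eq
        (f := { toFun := f, map_add' := h2, map_smul' := h3 }) fun X => by
          simpa using (h1 (-X) trivial).2
      exact ⟨Q, hQ, funext hQe⟩
  rw [himage]
  refine (isCompact_univ_pi fun _ => isCompact_Icc).inter_right (IsClosed.inter ?_ ?_)
  · simp only [Set.ofPred_forall]
    exact isClosed_iInter fun X => isClosed_iInter fun Y =>
      isClosed_eq (by fun_prop) (by fun_prop)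
  · simp only [Set.ofPred_forall]
    exact isClosed_iInter fun c => isClosed_iInter fun X =>
      isClosed_eq (by fun_prop) (by fun_prop)

/-- A worst-case expected loss is a coherent risk measure. -/
theorem IsCoherent.of_isGreatest {𝒬 : Set (FinAddProb P)} {h : Linf P → ℝ}
    (hm : ∀ X, IsGreatest ((fun Q : FinAddProb P => Q.expect (-X)) '' 𝒬) (h X)) :
    IsCoherent h := by
  have hle : ∀ X c, (∀ Q ∈ 𝒬, Q.expect (-X) ≤ c) → h X ≤ c := fun X c hc => by
    obtain ⟨Q, hQ, hQX⟩ := (hm X).1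
    exact hQX ▸ hc Q hQ
  have hge : ∀ Q ∈ 𝒬, ∀ X, Q.expect (-X) ≤ h X := fun Q hQ X => (hm X).2 ⟨Q, hQ, rfl⟩
  have htrans : ∀ (Q : FinAddProb P) (X : Linf P) (m : ℝ),
      Q.expect (-(X + Lp.const ∞ P m)) = Q.expect (-X) - m := fun Q X m => by
    simp only [Q.expect_neg, Q.expect_add, Q.expect_const]
    ring
  have hsmul : ∀ (Q : FinAddProb P) (X : Linf P) (c : ℝ), 0 ≤ c →
      Q.expect (-(c • X)) = c * Q.expect (-X) := fun Q X c hc => by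
    rw [← smul_neg, Q.expect_smul_of_nonneg hc]
  refine IsCoherent.of_subadditive ⟨⟨fun X Y hXY => hle Y _ fun Q hQ => ?_,
    fun X m => le_antisymm (hle _ _ fun Q hQ => ?_) ?_⟩,
    fun X c hc => le_antisymm (hle _ _ fun Q hQ => ?_) ?_⟩ fun X Y => hle _ _ fun Q hQ => ?_
  · exact (Q.expect_mono (neg_le_neg ((Lp.coeFn_le X Y).1 hXY))).trans (hge Q hQ X)
  · rw [htrans]
    linarith [hge Q hQ X]
  · rw [sub_le_iff_le_add]
    refine hle X _ fun Q hQ => ?_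
    have := hge Q hQ (X + Lp.const ∞ P m)
    rw [htrans] at this
    linarith
  · rw [hsmul Q X c hc]
    exact mul_le_mul_of_nonneg_left (hge Q hQ X) hc
  · obtain ⟨Q, hQ, hQX⟩ := (hm X).1
    rw [← hQX, ← hsmul Q X c hc]
    exact hge Q hQ _
  · rw [neg_add, Q.expect_add]
    exact add_le_add (hge Q hQ X) (hge Q hQ Y)

end RiskMeasure

end

theorem mainTheorem2 {Ω : Type u} [MeasurableSpace Ω] (P : Measure Ω) [IsProbabilityMeasure P]
    [P.IsComplete] (ρ : RiskMeasure.Linf P → ℝ) :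
    List.TFAE [
      RiskMeasure.IsPosHomogeneous ρ,
      ∃ (Λ : Type u) (𝒬 : Λ → Set (RiskMeasure.FinAddProb P)),
        (∀ l, (𝒬 l).Nonempty ∧ IsCompact (𝒬 l) ∧ RiskMeasure.FinAddProb.ConvexSet (𝒬 l)) ∧
        ∀ X : RiskMeasure.Linf P, ∃ m : Λ → ℝ,
          (∀ l, IsGreatest ((fun Q : RiskMeasure.FinAddProb P => Q.expect (-X)) '' 𝒬 l) (m l)) ∧
          IsLeast (Set.range m) (ρ X),
      ∃ (Λ : Type u) (h : Λ → RiskMeasure.Linf P → ℝ),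
        (∀ l, RiskMeasure.IsCoherent (h l)) ∧
        ∀ X : RiskMeasure.Linf P, IsLeast (Set.range fun l => h l X) (ρ X),
      ∀ X : RiskMeasure.Linf P,
        IsGLB {r : ℝ | ∃ h : RiskMeasure.Linf P → ℝ,
          RiskMeasure.IsCoherent h ∧ (∀ Y, ρ Y ≤ h Y) ∧ r = h X} (ρ X)] := by
  open RiskMeasure in
  tfae_have 1 → 3 := fun hρ => by
    have hZ : ∀ X, ρ (X + Lp.const ∞ P (ρ X)) ≤ 0 := fun X => by
      rw [hρ.translation, sub_self]
    refine ⟨Linf P, fun X => conicRisk (X + Lp.const ∞ P (ρ X)),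
      fun X => hρ.isCoherent_conicRisk (hZ X),
      fun X => ⟨⟨X, hρ.conicRisk_add_const_self rfl⟩, ?_⟩⟩
    rintro _ ⟨Y, rfl⟩
    exact hρ.le_conicRisk (hZ Y) X
  tfae_have 3 → 4 := by
    rintro ⟨Λ, h, hcoh, hmin⟩ X
    refine ⟨?_, fun c hc => ?_⟩
    · rintro _ ⟨g, -, hg, rfl⟩
      exact hg X
    · obtain ⟨l, hl⟩ := (hmin X).1
      -- The member attaining the minimum at `X` is itself a competitor in the infimum.
      exact hc ⟨h l, hcoh l, fun Y => (hmin Y).2 ⟨l, rfl⟩, hl.symm⟩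
  tfae_have 4 → 1 := fun hρ => by
    have hset : ∀ X, {r : ℝ | ∃ h : Linf P → ℝ, IsCoherent h ∧ (∀ Y, ρ Y ≤ h Y) ∧ r = h X} =
        (fun h => h X) '' {h : Linf P → ℝ | IsCoherent h ∧ ∀ Y, ρ Y ≤ h Y} := fun X => by
      ext r
      simp only [Set.mem_ofPred_eq, Set.mem_image, and_assoc, eq_comm]
    refine IsPosHomogeneous.of_isGLB (fun h hh => hh.1) ?_ fun X => hset X ▸ hρ X
    -- The empty set has no greatest lower bound in `ℝ`, which encodes `inf ∅ = +∞`.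
    obtain ⟨_, h, hcoh, hle, -⟩ := (hρ 0).nonempty
    exact ⟨h, hcoh, hle⟩
  tfae_have 3 → 2 := by
    rintro ⟨Λ, h, hcoh, hmin⟩
    refine ⟨Λ, fun l => dominatedScenarios (h l), fun l => ⟨?_,
      (hcoh l).isCompact_dominatedScenarios, (hcoh l).convexSet_dominatedScenarios⟩,
      fun X => ⟨fun l => h l X, fun l => (hcoh l).isGreatest_dominatedScenarios X, hmin X⟩⟩
    exact ((hcoh l).isGreatest_dominatedScenarios 0).nonempty.of_image
  tfae_have 2 → 3 := by
    rintro ⟨Λ, 𝒬, -, hmin⟩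
    choose m hm hleast using hmin
    exact ⟨Λ, fun l X => m X l, fun l => IsCoherent.of_isGreatest fun X => hm X l, hleast⟩
  tfae_finish
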